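/- All graphs are finite, simple (undirected, without loops or multiple edges) and have at least one vertex. For a graph $G$ let $\alpha(G)$ be its independence number. For graphs $G$ and $H$ let $G\boxtimes H$ be their strong product: its vertex set is $V(G)\times V(H)$, and $(u,u')$, $(v,v')$ are adjacent if and only if $u=v$ and $u'v'\in E(H)$, or $uv\in E(G)$ and $u'=v'$, or $uv\in E(G)$ and $u'v'\in E(H)$. The relative fractional independence number of $G$ with respect to $H$ is $$\alpha^*(G|H)=\sup_{W}\frac{\alpha(G\boxtimes W)}{\alpha(H\boxtimes W)},$$ where the supremum is over all graphs $W$. The fractional independence number $\alpha^*(G)$ is the maximum of $\sum_{v\in V(G)}w_v$ over all weights $w_v\ge 0$ such that $\sum_{v\in S}w_v\le 1$ for every clique $S\subseteq V(G)$. The Lovász number is $$\vartheta(G)=\max\Big\{\sum_{i,j\in V(G)}B_{ij} : B\in\mathbb{R}^{V(G)\times V(G)}\text{ symmetric positive semidefinite},\ \operatorname{tr}B=1,\ B_{ij}=0\text{ for all } ij\in E(G)\Big\}.$$ Schrijver's variant $\vartheta^-(G)$ is the same maximum with the additional constraint that $B_{ij}\ge 0$ for all $i,j$; Szegedy's variant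 $\vartheta^+(G)$ is the same maximum as for $\vartheta(G)$ with the constraint $B_{ij}=0$ for $ij\in E(G)$ relaxed to $B_{ij}\le 0$ for $ij\in E(G)$. **Theorem.** For all graphs $G$ and $H$, $$\alpha^*(G|H)\ \ge\ \frac{X(G)}{X(H)}\ \ge\ \frac{1}{\alpha^*(H|G)},$$ where $X$ is any one of the following five invariants: the independence number $\alpha$, the fractional independence number $\alpha^*$, the Lovász number $\vartheta$, Schrijver's variant $\vartheta^-$, or Szegedy's variant $\vartheta^+$. -/

import Mathlib

namespace SimpleGraph

/-- The strong product of two graphs. -/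
def strongProd {V W : Type*} (G : SimpleGraph V) (H : SimpleGraph W) : SimpleGraph (V × W) where
  Adj p q := (p.1 = q.1 ∧ H.Adj p.2 q.2) ∨ (G.Adj p.1 q.1 ∧ p.2 = q.2) ∨
    (G.Adj p.1 q.1 ∧ H.Adj p.2 q.2)
  symm := ⟨by
    rintro p q (⟨h, h'⟩ | ⟨h, h'⟩ | ⟨h, h'⟩)
    · exact Or.inl ⟨h.symm, h'.symm⟩
    · exact Or.inr (Or.inl ⟨h.symm, h'.symm⟩)
    · exact Or.inr (Or.inr ⟨h.symm, h'.symm⟩)⟩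
  loopless := ⟨by
    rintro p (⟨_, h⟩ | ⟨h, _⟩ | ⟨h, _⟩)
    · exact H.irrefl h
    · exact G.irrefl h
    · exact G.irrefl h⟩

/-- The ratios `α(G ⊠ W) / α(H ⊠ W)`, where `W` runs over all nonempty finite graphs
(up to isomorphism, these are the graphs on the vertex sets `Fin (n + 1)`). -/
def indepRatios {V U : Type*} (G : SimpleGraph V) (H : SimpleGraph U) : Set ℝ :=
  {r | ∃ (n : ℕ) (W : SimpleGraph (Fin (n + 1))),
    r = ((G.strongProd W).indepNum : ℝ) / ((H.strongProd W).indepNum : ℝ)}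

/-- The relative fractional independence number `α*(G|H)`, the supremum of
`α(G ⊠ W) / α(H ⊠ W)` over all graphs `W`. -/
noncomputable def relFracIndepNum {V U : Type*} (G : SimpleGraph V) (H : SimpleGraph U) : ℝ :=
  sSup (indepRatios G H)

/-- The feasible values of the linear program for the fractional independence number: total
weights `∑ v, w v`, where `w ≥ 0` has weight at most `1` on every clique. -/
def fracIndepValues {V : Type*} [Fintype V] (G : SimpleGraph V) : Set ℝ :=
  {r | ∃ w : V → ℝ, (∀ v, 0 ≤ w v) ∧
    (∀ s : Finset V, G.IsClique (s : Set V) → ∑ v ∈ s, w v ≤ 1) ∧ r = ∑ v, w v}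

/-- The fractional independence number `α*(G)`. -/
noncomputable def fracIndepNum {V : Type*} [Fintype V] (G : SimpleGraph V) : ℝ :=
  sSup (fracIndepValues G)

/-- The feasible values of the semidefinite program for the Lovász number. -/
def lovaszValues {V : Type*} [Fintype V] (G : SimpleGraph V) : Set ℝ :=
  {r | ∃ B : Matrix V V ℝ, B.PosSemidef ∧ B.trace = 1 ∧ (∀ i j, G.Adj i j → B i j = 0) ∧
    r = ∑ i, ∑ j, B i j}

/-- The Lovász number `ϑ(G)`. -/
noncomputable def lovaszTheta {V : Type*} [Fintype V] (G : SimpleGraph V) : ℝ :=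
  sSup (lovaszValues G)

/-- The feasible values of the semidefinite program for Schrijver's variant of the Lovász number:
the matrix is moreover entrywise nonnegative. -/
def schrijverValues {V : Type*} [Fintype V] (G : SimpleGraph V) : Set ℝ :=
  {r | ∃ B : Matrix V V ℝ, B.PosSemidef ∧ B.trace = 1 ∧ (∀ i j, G.Adj i j → B i j = 0) ∧
    (∀ i j, 0 ≤ B i j) ∧ r = ∑ i, ∑ j, B i j}

/-- Schrijver's variant `ϑ⁻(G)` of the Lovász number. -/
noncomputable def schrijverTheta {V : Type*} [Fintype V] (G : SimpleGraph V) : ℝ :=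
  sSup (schrijverValues G)

/-- The feasible values of the semidefinite program for Szegedy's variant of the Lovász number:
the entries on edges are only required to be nonpositive. -/
def szegedyValues {V : Type*} [Fintype V] (G : SimpleGraph V) : Set ℝ :=
  {r | ∃ B : Matrix V V ℝ, B.PosSemidef ∧ B.trace = 1 ∧ (∀ i j, G.Adj i j → B i j ≤ 0) ∧
    r = ∑ i, ∑ j, B i j}

/-- Szegedy's variant `ϑ⁺(G)` of the Lovász number. -/
noncomputable def szegedyTheta {V : Type*} [Fintype V] (G : SimpleGraph V) : ℝ :=
  sSup (szegedyValues G)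


theorem bddAbove_indepRatios {V U : Type*} [Fintype V] [Finite U] [Nonempty U]
    (G : SimpleGraph V) (H : SimpleGraph U) : BddAbove (indepRatios G H) := by
  classical
  refine ⟨Fintype.card V, ?_⟩
  rintro r ⟨n, W, rfl⟩
  obtain ⟨u⟩ := ‹Nonempty U›
  apply div_le_of_le_mul₀ (by positivity) (by positivity)
  obtain ⟨s, hs⟩ := (G.strongProd W).exists_isNIndepSet_indepNum
  have hc : s.card ≤ Fintype.card V * (H.strongProd W).indepNum := by
    have h1 := Finset.card_eq_sum_card_fiberwise (f := Prod.fst) (s := s) (t := Finset.univ)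
      (fun _ _ => Finset.mem_coe.2 (Finset.mem_univ _))
    rw [h1, ← smul_eq_mul, Fintype.card, ← Finset.sum_const]
    refine Finset.sum_le_sum fun v _ => ?_
    have hinj : Set.InjOn (fun p : V × Fin (n + 1) => (u, p.2))
        ({p ∈ s | p.1 = v} : Finset _) := by
      rintro ⟨a, b⟩ hp ⟨c, d⟩ hq h
      simp_all
    rw [← Finset.card_image_of_injOn hinj]
    apply IsIndepSet.card_le_indepNum
    intro x hx y hy hxy hadj
    simp only [Finset.coe_image, Finset.coe_filter, Set.mem_image, Set.mem_ofPred_eq] at hx hy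
    obtain ⟨⟨a, b⟩, ⟨ha, rfl⟩, rfl⟩ := hx
    obtain ⟨⟨c, d⟩, ⟨hc, h⟩, rfl⟩ := hy
    dsimp only at h
    subst h
    rcases hadj with ⟨_, h⟩ | ⟨h, _⟩ | ⟨h, _⟩
    · exact hs.1 ha hc (fun e => h.ne (by simpa using e)) (Or.inl ⟨rfl, h⟩)
    · exact H.irrefl h
    · exact H.irrefl h
  rw [hs.2] at hc
  exact_mod_cast hc

theorem bddAbove_fracIndepValues {V : Type*} [Fintype V] (G : SimpleGraph V) :
    BddAbove (fracIndepValues G) := by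
  refine ⟨Fintype.card V, ?_⟩
  rintro r ⟨w, _, h, rfl⟩
  calc ∑ v, w v ≤ ∑ _v : V, (1 : ℝ) :=
        Finset.sum_le_sum fun v _ => by simpa using h {v} (by simp)
    _ = Fintype.card V := by simp

theorem schrijverValues_subset_lovaszValues {V : Type*} [Fintype V] (G : SimpleGraph V) :
    schrijverValues G ⊆ lovaszValues G := by
  rintro r ⟨B, h1, h2, h3, _, h5⟩
  exact ⟨B, h1, h2, h3, h5⟩

theorem lovaszValues_subset_szegedyValues {V : Type*} [Fintype V] (G : SimpleGraph V) :
    lovaszValues G ⊆ szegedyValues G := by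
  rintro r ⟨B, h1, h2, h3, h5⟩
  exact ⟨B, h1, h2, fun i j h => (h3 i j h).le, h5⟩

theorem bddAbove_szegedyValues {V : Type*} [Fintype V] (G : SimpleGraph V) :
    BddAbove (szegedyValues G) := by
  classical
  refine ⟨Fintype.card V, ?_⟩
  rintro r ⟨B, hB, ht, _, rfl⟩
  have key : ∀ i j, B i j ≤ (B i i + B j j) / 2 := by
    intro i j
    have h := hB.dotProduct_mulVec_nonneg (Pi.single i 1 - Pi.single j 1)
    have hs : B j i = B i j := by simpa using congrFun (congrFun hB.1 i) j
    simp [Matrix.mulVec_sub, sub_dotProduct, dotProduct_sub, hs] at h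
    linarith
  have ht' : ∑ i, B i i = 1 := ht
  calc ∑ i, ∑ j, B i j ≤ ∑ i, ∑ j, (B i i + B j j) / 2 :=
        Finset.sum_le_sum fun i _ => Finset.sum_le_sum fun j _ => key i j
    _ = Fintype.card V := by
        simp only [← Finset.sum_div, Finset.sum_add_distrib, Finset.sum_const, ht',
          Finset.card_univ, nsmul_eq_mul, mul_one]
        rw [← Finset.mul_sum, ht']
        ring

theorem one_mem_schrijverValues {V : Type*} [Fintype V] [Nonempty V] (G : SimpleGraph V) :
    (1 : ℝ) ∈ schrijverValues G := by
  classical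
  obtain ⟨v⟩ := ‹Nonempty V›
  refine ⟨Matrix.diagonal (Pi.single v 1), ?_, ?_, ?_, ?_, ?_⟩
  · refine Matrix.PosSemidef.diagonal fun i => ?_
    by_cases h : i = v <;> simp [h]
  · simp [Matrix.trace]
  · intro i j h
    exact Matrix.diagonal_apply_ne _ h.ne
  · intro i j
    simp only [Matrix.diagonal_apply, Pi.single_apply]
    split_ifs <;> simp
  · simp [Matrix.diagonal_apply]

end SimpleGraph

/-!
If `w ≥ 0` and `∑ p ∈ s, w p.2 ≤ b` for every independent set `s` of `H ⊠ Gᶜ`, then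
`∑ v, w v ≤ α*(G|H) * b`. For natural numbers `w v`, let `W` be the complement of `G` with each `v`
blown up to an independent set of size `w v`. The graph of the projection `W → G` is independent in
`G ⊠ W`, and a maximum independent set of `H ⊠ W` may be taken to be a union of fibres, so it comes
from such an `s`. Real weights follow by scaling and rounding down.

Each invariant `X` provides weights with total at least `X(G)` and with `b = X(H)`: the indicator of
a maximum independent set for `α`, an optimal solution of the linear program for `α*`. For the theta
numbers, write a feasible matrix as the Gram matrix of vectors `x v`, and let `y v` be the
projection of the unit vector `c` along `∑ v, x v` onto the ray of `x v`. The weights are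
`‖y v‖ ^ 2 = ⟪c, y v⟫`; their total is at least `‖∑ v, x v‖ ^ 2` by Cauchy-Schwarz. Summing the
`y p.2` over the points `p ∈ s` above each vertex of `H` gives a solution for `H`, up to scaling,
which shows that the weight of `s` is at most `ϑ(H)`.
-/

namespace StrongProduct

open SimpleGraph Finset Filter Topology
open scoped RealInnerProductSpace

section Blowup

variable {U V W : Type*}

theorem strongProd_adj_iff {G : SimpleGraph V} {H : SimpleGraph U} {p q : V × U} :
    (G.strongProd H).Adj p q ↔
      p ≠ q ∧ (p.1 = q.1 ∨ G.Adj p.1 q.1) ∧ (p.2 = q.2 ∨ H.Adj p.2 q.2) := by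
  have hG : G.Adj p.1 q.1 → p.1 ≠ q.1 := Adj.ne
  have hH : H.Adj p.2 q.2 → p.2 ≠ q.2 := Adj.ne
  simp only [strongProd, ne_eq, Prod.ext_iff]
  tauto

theorem eq_or_adj_of_isIndepSet_strongProd_compl {G : SimpleGraph V} {H : SimpleGraph U}
    {s : Set (U × V)} (hs : (H.strongProd Gᶜ).IsIndepSet s) {p q : U × V} (hp : p ∈ s) (hq : q ∈ s)
    (hpq : p.1 = q.1 ∨ H.Adj p.1 q.1) : p = q ∨ G.Adj p.2 q.2 := by
  by_contra! h
  refine hs hp hq h.1 (strongProd_adj_iff.2 ⟨h.1, hpq, ?_⟩)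
  by_cases h2 : p.2 = q.2
  exacts [Or.inl h2, Or.inr ⟨h2, h.2⟩]

theorem card_le_indepNum_strongProd_compl_comap [Finite V] [Fintype W] (G : SimpleGraph V)
    (f : W → V) : Fintype.card W ≤ (G.strongProd (Gᶜ.comap f)).indepNum := by
  let graph : W ↪ V × W := ⟨fun w => (f w, w), fun _ _ h => congrArg Prod.snd h⟩
  rw [← card_univ, ← card_map graph]
  apply IsIndepSet.card_le_indepNum
  simp only [coe_map, coe_univ, Set.image_univ]
  rintro _ ⟨w, rfl⟩ _ ⟨w', rfl⟩ hne hadj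
  obtain ⟨-, h, rfl | h'⟩ := strongProd_adj_iff.1 hadj
  · exact hne rfl
  · exact h.elim h'.1 h'.2

theorem exists_forall_le_on_fiber [Finite W] [Nonempty W] {α : Type*} [LinearOrder α] (f : W → V)
    (g : W → α) : ∃ σ : V → W, ∀ w, f (σ (f w)) = f w ∧ g w ≤ g (σ (f w)) := by
  have hmax (v : V) : ∃ w', ∀ w, f w = v → f w' = v ∧ g w ≤ g w' := by
    rcases (f ⁻¹' {v}).eq_empty_or_nonempty with hv | hv
    · exact ⟨Classical.arbitrary W, fun w hw => (hv.subset hw).elim⟩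
    · obtain ⟨w', hw', hle⟩ := Set.exists_max_image _ g (Set.toFinite _) hv
      exact ⟨w', fun w hw => ⟨hw', hle w hw⟩⟩
  choose σ hσ using hmax
  exact ⟨σ, fun w => hσ (f w) w rfl⟩

theorem isIndepSet_strongProd_of_comap {H : SimpleGraph U} {K : SimpleGraph V} {f : W → V}
    {t : Set (U × W)} (ht : (H.strongProd (K.comap f)).IsIndepSet t) (σ : V → W) :
    (H.strongProd K).IsIndepSet {p | f (σ p.2) = p.2 ∧ (p.1, σ p.2) ∈ t} := by
  rintro ⟨u, v⟩ ⟨hfp, hpt⟩ ⟨u', v'⟩ ⟨hfq, hqt⟩ hne hadj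
  obtain ⟨-, hu, hv⟩ := strongProd_adj_iff.1 hadj
  have hne' : (u, σ v) ≠ (u', σ v') := fun e => by
    obtain ⟨rfl, hσv⟩ := Prod.mk.inj e
    exact hne (Prod.ext rfl (hfp.symm.trans ((congrArg f hσv).trans hfq)))
  refine ht hpt hqt hne' (strongProd_adj_iff.2 ⟨hne', hu, hv.imp (congrArg σ) fun h => ?_⟩)
  simpa only [comap_adj, hfp, hfq] using h

-- The slices of a maximum independent set over the vertices of one fibre may all be replaced by the
-- largest of them, so that only one slice per vertex of `K` is left.
theorem exists_isIndepSet_indepNum_strongProd_comap_le [Finite U] [Finite V] [Fintype W]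
    [Nonempty W] [DecidableEq V] (H : SimpleGraph U) (K : SimpleGraph V) (f : W → V) :
    ∃ s : Finset (U × V), (H.strongProd K).IsIndepSet s ∧
      (H.strongProd (K.comap f)).indepNum ≤ ∑ p ∈ s, #{w | f w = p.2} := by
  classical
  cases nonempty_fintype U
  cases nonempty_fintype V
  obtain ⟨t, ht, hcard⟩ := (H.strongProd (K.comap f)).exists_isNIndepSet_indepNum
  let slice (w : W) : Finset (U × W) := {p ∈ t | p.2 = w}
  obtain ⟨σ, hσ⟩ := exists_forall_le_on_fiber f fun w => #(slice w)
  let s : Finset (U × V) := {p | f (σ p.2) = p.2 ∧ (p.1, σ p.2) ∈ t}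
  have hslice (w : W) : #(slice (σ (f w))) = #{p ∈ s | f w = p.2} := by
    refine card_nbij' (fun p => (p.1, f w)) (fun p => (p.1, σ (f w))) ?_ ?_ ?_ ?_
    all_goals
      rintro ⟨u, v⟩ h
      simp only [slice, s, mem_coe, mem_filter, mem_univ, true_and] at h ⊢
      grind
  refine ⟨s, by simpa [s] using isIndepSet_strongProd_of_comap ht σ, ?_⟩
  calc (H.strongProd (K.comap f)).indepNum
      = ∑ w, #(slice w) := by
        rw [← hcard]
        exact card_eq_sum_card_fiberwise fun _ _ => mem_coe.2 (mem_univ _)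
    _ ≤ ∑ w, #(slice (σ (f w))) := sum_le_sum fun w _ => (hσ w).2
    _ = ∑ w, #{p ∈ s | f w = p.2} := sum_congr rfl fun w _ => hslice w
    _ = ∑ p ∈ s, #{w | f w = p.2} := sum_card_bipartiteAbove_eq_sum_card_bipartiteBelow _

theorem exists_forall_card_fiber_eq [Fintype V] [DecidableEq V] (n : V → ℕ) {N : ℕ}
    (hN : ∑ v, n v = N) : ∃ f : Fin N → V, ∀ v, #{i | f i = v} = n v := by
  let e : (Σ v, Fin (n v)) ≃ Fin N := Fintype.equivFinOfCardEq (by simp [hN])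
  refine ⟨fun i => (e.symm i).1, fun v => ?_⟩
  calc #{i | (e.symm i).1 = v} = #{x : Σ v, Fin (n v) | x.1 = v} :=
        card_equiv e.symm (by simp)
    _ = n v := by
        rw [← Fintype.card_subtype, Fintype.card_congr (Equiv.sigmaSubtype v), Fintype.card_fin]

end Blowup

section Weights

variable {V U : Type*}

theorem relFracIndepNum_nonneg (G : SimpleGraph V) (H : SimpleGraph U) :
    0 ≤ G.relFracIndepNum H := by
  apply Real.sSup_nonneg
  rintro r ⟨n, W, rfl⟩
  positivity

theorem indepNum_pos [Finite V] [Nonempty V] (G : SimpleGraph V) : 0 < G.indepNum :=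
  Nat.pos_of_ne_zero fun h => by
    have := IsIndepSet.card_le_indepNum (G := G) (t := {Classical.arbitrary V}) (by simp)
    simp [h] at this

theorem indepNum_strongProd_le_relFracIndepNum_mul [Finite V] [Finite U] [Nonempty U]
    (G : SimpleGraph V) (H : SimpleGraph U) {n : ℕ} (W : SimpleGraph (Fin (n + 1))) :
    ((G.strongProd W).indepNum : ℝ) ≤ G.relFracIndepNum H * (H.strongProd W).indepNum := by
  cases nonempty_fintype V
  exact (div_le_iff₀ (Nat.cast_pos.2 (indepNum_pos _))).1
    (le_csSup (bddAbove_indepRatios G H) ⟨n, W, rfl⟩)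

theorem exists_isIndepSet_sum_natCast_le [Fintype V] [Finite U] [Nonempty U] (G : SimpleGraph V)
    (H : SimpleGraph U) (n : V → ℕ) :
    ∃ s : Finset (U × V), (H.strongProd Gᶜ).IsIndepSet s ∧
      ∑ v, (n v : ℝ) ≤ G.relFracIndepNum H * ∑ p ∈ s, (n p.2 : ℝ) := by
  classical
  cases hN : ∑ v, n v with
  | zero => exact ⟨∅, by simp, by simp [← Nat.cast_sum, hN]⟩
  | succ N =>
    obtain ⟨f, hf⟩ := exists_forall_card_fiber_eq n hN
    obtain ⟨s, hs, hle⟩ := exists_isIndepSet_indepNum_strongProd_comap_le H Gᶜ f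
    refine ⟨s, hs, ?_⟩
    calc ∑ v, (n v : ℝ) = Fintype.card (Fin (N + 1)) := by rw [← Nat.cast_sum, hN, Fintype.card_fin]
      _ ≤ (G.strongProd (Gᶜ.comap f)).indepNum :=
          Nat.cast_le.2 (card_le_indepNum_strongProd_compl_comap G f)
      _ ≤ G.relFracIndepNum H * (H.strongProd (Gᶜ.comap f)).indepNum :=
          indepNum_strongProd_le_relFracIndepNum_mul G H _
      _ ≤ G.relFracIndepNum H * ∑ p ∈ s, (n p.2 : ℝ) := by
          refine mul_le_mul_of_nonneg_left ?_ (relFracIndepNum_nonneg G H)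
          simp only [hf] at hle
          exact_mod_cast hle

theorem sum_le_relFracIndepNum_mul [Fintype V] [Finite U] [Nonempty U] {G : SimpleGraph V}
    {H : SimpleGraph U} {w : V → ℝ} (hw : ∀ v, 0 ≤ w v) {c : ℝ}
    (hc : ∀ s : Finset (U × V), (H.strongProd Gᶜ).IsIndepSet s → ∑ p ∈ s, w p.2 ≤ c) :
    ∑ v, w v ≤ G.relFracIndepNum H * c := by
  have hlim : Tendsto (fun x : ℝ => ∑ v, (⌊w v * x⌋₊ : ℝ) / x) atTop (𝓝 (∑ v, w v)) :=
    tendsto_finsetSum _ fun v _ => tendsto_nat_floor_mul_div_atTop (hw v)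
  refine le_of_tendsto hlim ((eventually_gt_atTop 0).mono fun x hx => ?_)
  obtain ⟨s, hs, hle⟩ := exists_isIndepSet_sum_natCast_le G H fun v => ⌊w v * x⌋₊
  rw [← sum_div, div_le_iff₀ hx, mul_assoc]
  refine hle.trans (mul_le_mul_of_nonneg_left ?_ (relFracIndepNum_nonneg G H))
  calc ∑ p ∈ s, (⌊w p.2 * x⌋₊ : ℝ) ≤ ∑ p ∈ s, w p.2 * x :=
        sum_le_sum fun p _ => Nat.floor_le (mul_nonneg (hw p.2) hx.le)
    _ = (∑ p ∈ s, w p.2) * x := (sum_mul ..).symm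
    _ ≤ c * x := mul_le_mul_of_nonneg_right (hc s hs) hx.le

theorem card_filter_le_indepNum_of_isIndepSet [Finite U] [DecidableEq V] {G : SimpleGraph V}
    {H : SimpleGraph U} {t : Finset V} (ht : G.IsIndepSet t) {s : Finset (U × V)}
    (hs : (H.strongProd Gᶜ).IsIndepSet s) : #{p ∈ s | p.2 ∈ t} ≤ H.indepNum := by
  classical
  cases nonempty_fintype U
  have heq {p q} (hp : p ∈ s ∧ p.2 ∈ t) (hq : q ∈ s ∧ q.2 ∈ t)
      (hpq : p.1 = q.1 ∨ H.Adj p.1 q.1) : p = q :=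
    (eq_or_adj_of_isIndepSet_strongProd_compl hs hp.1 hq.1 hpq).resolve_right fun h =>
      ht hp.2 hq.2 h.ne h
  have hinj : Set.InjOn Prod.fst ({p ∈ s | p.2 ∈ t} : Finset (U × V)) := fun p hp q hq h =>
    heq (mem_filter.1 hp) (mem_filter.1 hq) (Or.inl h)
  rw [← card_image_of_injOn hinj]
  apply IsIndepSet.card_le_indepNum
  rw [coe_image]
  rintro _ ⟨p, hp, rfl⟩ _ ⟨q, hq, rfl⟩ hne h
  exact hne (congrArg Prod.fst (heq (mem_filter.1 hp) (mem_filter.1 hq) (Or.inr h)))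

theorem indepNum_le_relFracIndepNum_mul [Finite V] [Finite U] [Nonempty U] (G : SimpleGraph V)
    (H : SimpleGraph U) : (G.indepNum : ℝ) ≤ G.relFracIndepNum H * H.indepNum := by
  classical
  cases nonempty_fintype V
  obtain ⟨t, ht, hcard⟩ := G.exists_isNIndepSet_indepNum
  calc (G.indepNum : ℝ) = ∑ v, if v ∈ t then 1 else 0 := by simp [hcard]
    _ ≤ G.relFracIndepNum H * H.indepNum :=
        sum_le_relFracIndepNum_mul (fun v => by positivity) fun s hs => by
          rw [sum_boole]
          exact Nat.cast_le.2 (card_filter_le_indepNum_of_isIndepSet ht hs)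

theorem sum_le_fracIndepNum_of_isIndepSet [Fintype U] {G : SimpleGraph V} {H : SimpleGraph U}
    {w : V → ℝ} (hw : ∀ v, 0 ≤ w v)
    (hclique : ∀ t : Finset V, G.IsClique t → ∑ v ∈ t, w v ≤ 1) {s : Finset (U × V)}
    (hs : (H.strongProd Gᶜ).IsIndepSet s) : ∑ p ∈ s, w p.2 ≤ H.fracIndepNum := by
  classical
  refine le_csSup (bddAbove_fracIndepValues H) ⟨fun u => ∑ p ∈ s with p.1 = u, w p.2,
    fun u => sum_nonneg fun p _ => hw p.2, fun k hk => ?_, (sum_fiberwise s _ _).symm⟩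
  have hadj {p q} (hp : p ∈ s ∧ p.1 ∈ k) (hq : q ∈ s ∧ q.1 ∈ k) : p = q ∨ G.Adj p.2 q.2 :=
    eq_or_adj_of_isIndepSet_strongProd_compl hs hp.1 hq.1
      (or_iff_not_imp_left.2 fun h => hk hp.2 hq.2 h)
  have hinj : Set.InjOn Prod.snd ({p ∈ s | p.1 ∈ k} : Finset (U × V)) := fun p hp q hq h =>
    (hadj (mem_filter.1 hp) (mem_filter.1 hq)).resolve_right fun h' => h'.ne h
  have himage : G.IsClique (image Prod.snd {p ∈ s | p.1 ∈ k} : Finset V) := by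
    rw [coe_image]
    rintro _ ⟨p, hp, rfl⟩ _ ⟨q, hq, rfl⟩ hne
    exact (hadj (mem_filter.1 hp) (mem_filter.1 hq)).resolve_left fun h => hne (congrArg Prod.snd h)
  calc ∑ u ∈ k, ∑ p ∈ s with p.1 = u, w p.2
      = ∑ p ∈ s with p.1 ∈ k, w p.2 := sum_fiberwise_eq_sum_filter ..
    _ = ∑ v ∈ image Prod.snd {p ∈ s | p.1 ∈ k}, w v := (sum_image hinj).symm
    _ ≤ 1 := hclique _ himage

theorem fracIndepNum_le_relFracIndepNum_mul [Fintype V] [Fintype U] [Nonempty U]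
    (G : SimpleGraph V) (H : SimpleGraph U) :
    G.fracIndepNum ≤ G.relFracIndepNum H * H.fracIndepNum := by
  refine csSup_le ⟨0, 0, by simp⟩ ?_
  rintro _ ⟨w, hw, hclique, rfl⟩
  exact sum_le_relFracIndepNum_mul hw fun s hs => sum_le_fracIndepNum_of_isIndepSet hw hclique hs

theorem fracIndepNum_pos [Fintype U] [Nonempty U] (H : SimpleGraph U) : 0 < H.fracIndepNum := by
  classical
  let u := Classical.arbitrary U
  refine zero_lt_one.trans_le (le_csSup (bddAbove_fracIndepValues H)
    ⟨Pi.single u 1, fun v => ?_, fun s _ => ?_, by simp⟩)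
  · rw [Pi.single_apply]
    positivity
  simp only [Pi.single_apply, sum_ite_eq']
  split_ifs <;> simp

end Weights

section Theta

variable {U V E : Type*} [NormedAddCommGroup E] [InnerProductSpace ℝ E]

theorem sum_sum_inner_eq_norm_sum_sq (s : Finset V) (x : V → E) :
    ∑ i ∈ s, ∑ j ∈ s, ⟪x i, x j⟫ = ‖∑ i ∈ s, x i‖ ^ 2 := by
  rw [← real_inner_self_eq_norm_sq, sum_inner]
  simp only [inner_sum]

theorem norm_sum_sq_le_sum_norm_sq_of_inner_nonpos {s : Finset V} {x : V → E}
    (hx : (s : Set V).Pairwise fun i j => ⟪x i, x j⟫ ≤ 0) :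
    ‖∑ i ∈ s, x i‖ ^ 2 ≤ ∑ i ∈ s, ‖x i‖ ^ 2 := by
  classical
  rw [← sum_sum_inner_eq_norm_sum_sq]
  refine sum_le_sum fun i hi => ?_
  rw [← add_sum_erase _ _ hi, real_inner_self_eq_norm_sq]
  exact add_le_of_nonpos_right (sum_nonpos fun j hj =>
    hx hi (mem_of_mem_erase hj) (ne_of_mem_erase hj).symm)

theorem exists_gram_eq_of_posSemidef [Finite V] {B : Matrix V V ℝ} (hB : B.PosSemidef) :
    ∃ (m : ℕ) (x : V → EuclideanSpace ℝ (Fin m)), Matrix.gram ℝ x = B := by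
  obtain ⟨m, v, rfl⟩ := Matrix.posSemidef_iff_eq_sum_vecMulVec.1 hB
  refine ⟨m, fun i => WithLp.toLp 2 fun k => v k i, ?_⟩
  ext i j
  simp [Matrix.gram_apply, Matrix.sum_apply, Matrix.vecMulVec_apply, PiLp.inner_apply, mul_comm]

-- `a • x` is the point of the ray through `x` that is closest to `c`.
theorem exists_smul_inner_eq_norm_sq (c x : E) :
    ∃ a : ℝ, 0 ≤ a ∧ ⟪c, a • x⟫ = ‖a • x‖ ^ 2 ∧ ⟪c, x⟫ ≤ ‖x‖ * ‖a • x‖ := by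
  rcases eq_or_ne x 0 with rfl | hx
  · exact ⟨0, by simp⟩
  rcases le_total ⟪c, x⟫ 0 with h | h
  · exact ⟨0, by simpa using h⟩
  have hx' : ‖x‖ ≠ 0 := norm_ne_zero_iff.2 hx
  refine ⟨⟪c, x⟫ / ‖x‖ ^ 2, by positivity, ?_, ?_⟩
  · rw [inner_smul_right, norm_smul, Real.norm_of_nonneg (by positivity)]
    field_simp
  · rw [norm_smul, Real.norm_of_nonneg (by positivity)]
    field_simp
    rfl

/-- The feasible values of the semidefinite program for the theta number `thetaNum C D G`. -/
def thetaValues [Fintype V] (C D : PointedCone ℝ ℝ) (G : SimpleGraph V) : Set ℝ :=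
  {r | ∃ B : Matrix V V ℝ, B.PosSemidef ∧ B.trace = 1 ∧ (∀ i j, G.Adj i j → B i j ∈ C) ∧
    (∀ i j, B i j ∈ D) ∧ r = ∑ i, ∑ j, B i j}

/-- The common generalization of the Lovász number and its variants, in which the matrix entries
on the edges are restricted to a cone `C` and all matrix entries to a cone `D`. -/
noncomputable def thetaNum [Fintype V] (C D : PointedCone ℝ ℝ) (G : SimpleGraph V) : ℝ :=
  sSup (thetaValues C D G)

/-- A vector representation of `G`: its Gram matrix is feasible, up to the normalization of the
trace, for the semidefinite program defining `thetaNum C D G`. Summing and rescaling the vectors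
turns one representation into another. -/
structure IsThetaRep (C D : PointedCone ℝ ℝ) (G : SimpleGraph V) (x : V → E) : Prop where
  adj_mem : ∀ i j, G.Adj i j → ⟪x i, x j⟫ ∈ C
  inner_mem : ∀ i j, ⟪x i, x j⟫ ∈ D

variable {C D : PointedCone ℝ ℝ} {G : SimpleGraph V} {H : SimpleGraph U} {x : V → E}

theorem exists_isThetaRep_of_mem_thetaValues [Fintype V] {r : ℝ} (hr : r ∈ thetaValues C D G) :
    ∃ (m : ℕ) (x : V → EuclideanSpace ℝ (Fin m)), IsThetaRep C D G x ∧ ∑ i, ‖x i‖ ^ 2 = 1 ∧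
      r = ‖∑ i, x i‖ ^ 2 := by
  obtain ⟨B, hB, htr, hC, hD, rfl⟩ := hr
  obtain ⟨m, x, rfl⟩ := exists_gram_eq_of_posSemidef hB
  refine ⟨m, x, ⟨hC, hD⟩, ?_, sum_sum_inner_eq_norm_sum_sq univ x⟩
  simpa [Matrix.trace] using htr

theorem thetaNum_nonneg [Fintype V] : 0 ≤ thetaNum C D G := by
  refine Real.sSup_nonneg fun r hr => ?_
  obtain ⟨m, x, -, -, rfl⟩ := exists_isThetaRep_of_mem_thetaValues hr
  positivity

theorem bddAbove_thetaValues [Fintype V] (hC : ∀ a ∈ C, a ≤ 0) :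
    BddAbove (thetaValues C D G) := by
  refine (bddAbove_szegedyValues G).mono ?_
  rintro r ⟨B, hB, htr, hadj, -, hr⟩
  exact ⟨B, hB, htr, fun i j h => hC _ (hadj i j h), hr⟩

theorem thetaNum_pos [Fintype V] [Nonempty V] (hC : ∀ a ∈ C, a ≤ 0) (hD : ∀ a, 0 ≤ a → a ∈ D) :
    0 < thetaNum C D G := by
  obtain ⟨B, hB, htr, hadj, hnonneg, hr⟩ := one_mem_schrijverValues G
  exact zero_lt_one.trans_le (le_csSup (bddAbove_thetaValues hC)
    ⟨B, hB, htr, fun i j h => by simp [hadj i j h], fun i j => hD _ (hnonneg i j), hr⟩)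

theorem IsThetaRep.smul (hx : IsThetaRep C D G x) {a : V → ℝ} (ha : ∀ i, 0 ≤ a i) :
    IsThetaRep C D G fun i => a i • x i := by
  have smul_mem {K : PointedCone ℝ ℝ} {i j} (h : ⟪x i, x j⟫ ∈ K) : ⟪a i • x i, a j • x j⟫ ∈ K := by
    rw [real_inner_smul_left, real_inner_smul_right, ← mul_assoc]
    exact PointedCone.smul_mem K (mul_nonneg (ha i) (ha j)) h
  exact ⟨fun i j h => smul_mem (hx.adj_mem i j h), fun i j => smul_mem (hx.inner_mem i j)⟩

theorem IsThetaRep.norm_sum_sq_le [Fintype V] (hC : ∀ a ∈ C, a ≤ 0) (hx : IsThetaRep C D G x) :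
    ‖∑ i, x i‖ ^ 2 ≤ thetaNum C D G * ∑ i, ‖x i‖ ^ 2 := by
  set t := ∑ i, ‖x i‖ ^ 2
  rcases (show 0 ≤ t by positivity).eq_or_lt' with ht | ht
  · have hx0 : ∀ i, x i = 0 := by
      simpa [t, sum_eq_zero_iff_of_nonneg fun i _ => sq_nonneg ‖x i‖] using ht
    simp [hx0, ht]
  have hnorm (v : E) : ‖(√t)⁻¹ • v‖ ^ 2 = ‖v‖ ^ 2 / t := by
    rw [norm_smul, mul_pow, Real.norm_eq_abs, sq_abs, inv_pow, Real.sq_sqrt ht.le, inv_mul_eq_div]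
  have hy := hx.smul fun _ => inv_nonneg.2 (Real.sqrt_nonneg t)
  rw [← div_le_iff₀ ht]
  refine le_csSup (bddAbove_thetaValues hC)
    ⟨_, Matrix.posSemidef_gram ℝ fun i => (√t)⁻¹ • x i, ?_, hy.adj_mem, hy.inner_mem, ?_⟩
  · simp only [Matrix.trace, Matrix.diag_apply, Matrix.gram_apply, real_inner_self_eq_norm_sq]
    rw [sum_congr rfl fun i _ => hnorm (x i), ← sum_div, div_self ht.ne']
  · simp only [Matrix.gram_apply, sum_sum_inner_eq_norm_sum_sq, ← smul_sum, hnorm]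

theorem IsThetaRep.exists_handle [Fintype V] (hx : IsThetaRep C D G x) :
    ∃ (c : E) (y : V → E), ‖c‖ ≤ 1 ∧ IsThetaRep C D G y ∧ (∀ i, ⟪c, y i⟫ = ‖y i‖ ^ 2) ∧
      ‖∑ i, x i‖ ^ 2 ≤ (∑ i, ‖x i‖ ^ 2) * ∑ i, ‖y i‖ ^ 2 := by
  let c := ‖∑ i, x i‖⁻¹ • ∑ i, x i
  choose a ha hay hle using fun i => exists_smul_inner_eq_norm_sq c (x i)
  refine ⟨c, fun i => a i • x i, ?_, hx.smul ha, hay, ?_⟩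
  · rw [norm_smul, norm_inv, norm_norm]
    exact inv_mul_le_one
  have hc : ‖∑ i, x i‖ = ∑ i, ⟪c, x i⟫ := by
    rw [← inner_sum, real_inner_smul_left, real_inner_self_eq_norm_sq, sq]
    rcases eq_or_ne ‖∑ i, x i‖ 0 with h | h
    · simp [h]
    · field_simp
  calc ‖∑ i, x i‖ ^ 2 ≤ (∑ i, ‖x i‖ * ‖a i • x i‖) ^ 2 :=
        pow_le_pow_left₀ (norm_nonneg _) (hc.trans_le (sum_le_sum fun i _ => hle i)) 2
    _ ≤ (∑ i, ‖x i‖ ^ 2) * ∑ i, ‖a i • x i‖ ^ 2 := sum_mul_sq_le_sq_mul_sq ..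

theorem IsThetaRep.sum_fiber [DecidableEq U] {s : Finset (U × V)} (hx : IsThetaRep C D G x)
    (hs : (H.strongProd Gᶜ).IsIndepSet s) :
    IsThetaRep C D H fun u => ∑ p ∈ s with p.1 = u, x p.2 := by
  constructor
  · intro u u' h
    simp only [sum_inner, inner_sum]
    refine C.sum_mem fun q hq => C.sum_mem fun p hp => hx.adj_mem _ _ ?_
    obtain ⟨hps, rfl⟩ := mem_filter.1 hp
    obtain ⟨hqs, rfl⟩ := mem_filter.1 hq
    exact (eq_or_adj_of_isIndepSet_strongProd_compl hs hps hqs (Or.inr h)).resolve_left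
      fun e => h.ne (congrArg Prod.fst e)
  · intro u u'
    simp only [sum_inner, inner_sum]
    exact D.sum_mem fun _ _ => D.sum_mem fun _ _ => hx.inner_mem _ _

theorem IsThetaRep.sum_norm_sq_le_thetaNum [Fintype U] (hC : ∀ a ∈ C, a ≤ 0)
    (hx : IsThetaRep C D G x) {c : E} (hc : ‖c‖ ≤ 1) (hcx : ∀ i, ⟪c, x i⟫ = ‖x i‖ ^ 2)
    {s : Finset (U × V)} (hs : (H.strongProd Gᶜ).IsIndepSet s) :
    ∑ p ∈ s, ‖x p.2‖ ^ 2 ≤ thetaNum C D H := by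
  classical
  let z (u : U) : E := ∑ p ∈ s with p.1 = u, x p.2
  set M := ∑ p ∈ s, ‖x p.2‖ ^ 2
  have hz : ∑ u, ‖z u‖ ^ 2 ≤ M := by
    simp only [M, ← sum_fiberwise s Prod.fst fun p => ‖x p.2‖ ^ 2]
    refine sum_le_sum fun u _ =>
      norm_sum_sq_le_sum_norm_sq_of_inner_nonpos fun p hp q hq hne => hC _ ?_
    simp only [coe_filter, Set.mem_ofPred_eq] at hp hq
    exact hx.adj_mem _ _ <| (eq_or_adj_of_isIndepSet_strongProd_compl hs hp.1 hq.1
      (Or.inl (hp.2.trans hq.2.symm))).resolve_left hne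
  have hM : M ≤ ‖∑ u, z u‖ :=
    calc
      M = ⟪c, ∑ u, z u⟫ := by
        rw [sum_fiberwise s Prod.fst fun p => x p.2, inner_sum]
        exact sum_congr rfl fun p _ => (hcx p.2).symm
      _ ≤ ‖c‖ * ‖∑ u, z u‖ := real_inner_le_norm _ _
      _ ≤ ‖∑ u, z u‖ := mul_le_of_le_one_left (norm_nonneg _) hc
  have hM0 : 0 ≤ M := by positivity
  have hMM : M * M ≤ thetaNum C D H * M :=
    calc M * M ≤ ‖∑ u, z u‖ ^ 2 := by rw [← sq]; exact pow_le_pow_left₀ hM0 hM 2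
      _ ≤ thetaNum C D H * ∑ u, ‖z u‖ ^ 2 := (hx.sum_fiber hs).norm_sum_sq_le hC
      _ ≤ thetaNum C D H * M := mul_le_mul_of_nonneg_left hz thetaNum_nonneg
  rcases hM0.eq_or_lt with h | h
  · exact h ▸ thetaNum_nonneg
  · exact le_of_mul_le_mul_right hMM h

theorem thetaNum_le_relFracIndepNum_mul [Fintype V] [Fintype U] [Nonempty U]
    (hC : ∀ a ∈ C, a ≤ 0) : thetaNum C D G ≤ G.relFracIndepNum H * thetaNum C D H := by
  refine Real.sSup_le (fun r hr => ?_) (mul_nonneg (relFracIndepNum_nonneg G H) thetaNum_nonneg)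
  obtain ⟨m, x, hx, hx1, rfl⟩ := exists_isThetaRep_of_mem_thetaValues hr
  obtain ⟨c, y, hc, hy, hcy, hle⟩ := hx.exists_handle
  rw [hx1, one_mul] at hle
  exact hle.trans (sum_le_relFracIndepNum_mul (fun _ => sq_nonneg _) fun s hs =>
    hy.sum_norm_sq_le_thetaNum hC hc hcy hs)

theorem lovaszTheta_eq_thetaNum [Fintype V] (G : SimpleGraph V) :
    G.lovaszTheta = thetaNum ⊥ ⊤ G := by
  simp [lovaszTheta, thetaNum, lovaszValues, thetaValues]

theorem schrijverTheta_eq_thetaNum [Fintype V] (G : SimpleGraph V) :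
    G.schrijverTheta = thetaNum ⊥ (PointedCone.positive ℝ ℝ) G := by
  simp [schrijverTheta, thetaNum, schrijverValues, thetaValues]

open scoped Pointwise in
theorem szegedyTheta_eq_thetaNum [Fintype V] (G : SimpleGraph V) :
    G.szegedyTheta = thetaNum (-PointedCone.positive ℝ ℝ) ⊤ G := by
  simp [szegedyTheta, thetaNum, szegedyValues, thetaValues]

end Theta

section Ratios

theorem div_bounds_of_le_mul {x y a b : ℝ} (hx : 0 < x) (hy : 0 < y) (ha : x ≤ a * y)
    (hb : y ≤ b * x) : a ≥ x / y ∧ x / y ≥ 1 / b := by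
  have hb0 : 0 < b := pos_of_mul_pos_left (hy.trans_le hb) hx.le
  refine ⟨(div_le_iff₀ hy).2 ha, ?_⟩
  rw [ge_iff_le, div_le_div_iff₀ hb0 hy]
  linarith

variable {V U : Type*} [Nonempty V] [Nonempty U]

theorem indepNum_div_bounds [Finite V] [Finite U] (G : SimpleGraph V) (H : SimpleGraph U) :
    G.relFracIndepNum H ≥ (G.indepNum : ℝ) / H.indepNum ∧
      (G.indepNum : ℝ) / H.indepNum ≥ 1 / H.relFracIndepNum G :=
  div_bounds_of_le_mul (Nat.cast_pos.2 (indepNum_pos G)) (Nat.cast_pos.2 (indepNum_pos H))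
    (indepNum_le_relFracIndepNum_mul G H) (indepNum_le_relFracIndepNum_mul H G)

variable [Fintype V] [Fintype U]

theorem fracIndepNum_div_bounds (G : SimpleGraph V) (H : SimpleGraph U) :
    G.relFracIndepNum H ≥ G.fracIndepNum / H.fracIndepNum ∧
      G.fracIndepNum / H.fracIndepNum ≥ 1 / H.relFracIndepNum G :=
  div_bounds_of_le_mul (fracIndepNum_pos G) (fracIndepNum_pos H)
    (fracIndepNum_le_relFracIndepNum_mul G H) (fracIndepNum_le_relFracIndepNum_mul H G)

theorem thetaNum_div_bounds {C D : PointedCone ℝ ℝ} (hC : ∀ a ∈ C, a ≤ 0)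
    (hD : ∀ a, 0 ≤ a → a ∈ D) (G : SimpleGraph V) (H : SimpleGraph U) :
    G.relFracIndepNum H ≥ thetaNum C D G / thetaNum C D H ∧
      thetaNum C D G / thetaNum C D H ≥ 1 / H.relFracIndepNum G :=
  div_bounds_of_le_mul (thetaNum_pos hC hD) (thetaNum_pos hC hD)
    (thetaNum_le_relFracIndepNum_mul hC) (thetaNum_le_relFracIndepNum_mul hC)

end Ratios

end StrongProduct

open StrongProduct

theorem theorem3 {V U : Type*} [Fintype V] [Nonempty V] [Fintype U] [Nonempty U]
    (G : SimpleGraph V) (H : SimpleGraph U) :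
    (G.relFracIndepNum H ≥ (G.indepNum : ℝ) / (H.indepNum : ℝ) ∧
      (G.indepNum : ℝ) / (H.indepNum : ℝ) ≥ 1 / H.relFracIndepNum G) ∧
    (G.relFracIndepNum H ≥ G.fracIndepNum / H.fracIndepNum ∧
      G.fracIndepNum / H.fracIndepNum ≥ 1 / H.relFracIndepNum G) ∧
    (G.relFracIndepNum H ≥ G.lovaszTheta / H.lovaszTheta ∧
      G.lovaszTheta / H.lovaszTheta ≥ 1 / H.relFracIndepNum G) ∧
    (G.relFracIndepNum H ≥ G.schrijverTheta / H.schrijverTheta ∧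
      G.schrijverTheta / H.schrijverTheta ≥ 1 / H.relFracIndepNum G) ∧
    (G.relFracIndepNum H ≥ G.szegedyTheta / H.szegedyTheta ∧
      G.szegedyTheta / H.szegedyTheta ≥ 1 / H.relFracIndepNum G) := by
  simp only [lovaszTheta_eq_thetaNum, schrijverTheta_eq_thetaNum, szegedyTheta_eq_thetaNum]
  refine ⟨indepNum_div_bounds G H, fracIndepNum_div_bounds G H,
    thetaNum_div_bounds ?_ ?_ G H, thetaNum_div_bounds ?_ ?_ G H, thetaNum_div_bounds ?_ ?_ G H⟩
  all_goals simp +contextual
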